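/- All vector spaces are real. For a net $(x_\alpha)_{\alpha\in A}$ in a vector lattice $L$ and $x\in L$, we write $x_\alpha\xrightarrow{o}x$ (order convergence in $L$) when there is a net $(y_\beta)_{\beta\in B}$ in $L$, over a possibly different directed index set, with $y_\beta\downarrow 0$ in $L$, such that for every $\beta_0\in B$ there is $\alpha_0\in A$ with $|x-x_\alpha|\le y_{\beta_0}$ for all $\alpha\ge\alpha_0$. A subset of $L$ is order closed in $L$ when it contains the order limits in $L$ of all nets in it. A linear operator $T\colon L\to M$ between vector lattices is order continuous when $x_\alpha\xrightarrow{o}0$ in $L$ implies $Tx_\alpha\xrightarrow{o}0$ in $M$. A vector sublattice of $L$ is regular in $L$ when its inclusion map into $L$ is order continuous. A band is an order closed ideal (solid linear subspace). An element $e\geq 0$ of an Archimedean vector lattice is a weak order unit when $|x|\wedge e=0$ implies $x=0$ (equivalently, when the band generated by $e$ is the whole space). Let $E$ be a Dedekind complete vector lattice, let $\mathcal L_{\mathrm{ob}}(E)$ be the vector lattice algebra of order bounded linear operators on $E$, ordered by $T\le S$ if and only if $Tx\le Sx$ for all $x\ge 0$, and let $\mathrm{Orth}(E)\subseteq\mathcal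 L_{\mathrm{ob}}(E)$ be the vector lattice subalgebra of orthomorphisms, i.e. of the order bounded linear operators that leave every band of $E$ invariant. **Theorem.** Let $\mathcal S$ be a non-empty set of order continuous linear operators on $E$, each of which is positive or negative. Then the commutant $$\mathcal S'_{\mathrm{Orth}}=\{T\in\mathrm{Orth}(E): TS=ST\text{ for all }S\in\mathcal S\}$$ of $\mathcal S$ in $\mathrm{Orth}(E)$ is a vector lattice subalgebra of $\mathrm{Orth}(E)$ (i.e. a vector sublattice that is closed under composition) that contains the identity operator $I$ as a weak order unit. Furthermore: 1. $\mathcal S'_{\mathrm{Orth}}$ is an order closed vector sublattice of every regular vector sublattice $\mathcal F$ of $\mathcal L_{\mathrm{ob}}(E)$ that contains $\mathcal S'_{\mathrm{Orth}}$ (order closed with respect to order convergence in $\mathcal F$); 2. $\mathcal S'_{\mathrm{Orth}}$ is a regular vector sublattice of every Dedekind complete regular vector sublattice of $\mathcal L_{\mathrm{ob}}(E)$ that contains $\mathcal S'_{\mathrm{Orth}}$; 3. $\mathcal S'_{\mathrm{Orth}}$ is a Dedekind complete vector lattice. -/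

import Mathlib

universe u v

noncomputable section

/-! ### Order convergence, order closed sets, order continuity, bands -/

section OrderConvergence

/-- Order convergence of a net `x` to `l`: there is a net `y` (over a possibly different directed
index set) with `y ↓ 0` such that every `y b` eventually dominates `|l - x a|`.
It is no restriction to take the index set of `y` in the universe of the space, since the net `y`
may be replaced with its range, indexed by itself. -/
def OrderConverges {L : Type u} [AddCommGroup L] [Lattice L] {A : Type v} [Preorder A]
    (x : A → L) (l : L) : Prop :=
  ∃ (B : Type u) (_ : Preorder B) (_ : IsDirectedOrder B) (_ : Nonempty B) (y : B → L),
    Antitone y ∧ IsGLB (Set.range y) 0 ∧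
      ∀ b : B, ∃ a₀ : A, ∀ a : A, a₀ ≤ a → |l - x a| ≤ y b

/-- The order adherence of a set: all order limits of nets in the set.  Nets with index
set in the universe of the space suffice to obtain all order limits. -/
def orderAdherence {L : Type u} [AddCommGroup L] [Lattice L] (s : Set L) : Set L :=
  {l | ∃ (A : Type u) (_ : Preorder A) (_ : IsDirectedOrder A) (_ : Nonempty A) (x : A → L),
    (∀ a, x a ∈ s) ∧ OrderConverges x l}

/-- A set is order closed when it coincides with its order adherence. -/
def IsOrderClosed {L : Type u} [AddCommGroup L] [Lattice L] (s : Set L) : Prop :=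
  orderAdherence s = s

/-- A linear operator is order continuous when it maps nets that are order convergent to `0`
to nets that are order convergent to `0`. -/
def IsOrderContinuous {L : Type u} {M : Type v} [AddCommGroup L] [Lattice L] [Module ℝ L]
    [AddCommGroup M] [Lattice M] [Module ℝ M] (T : L →ₗ[ℝ] M) : Prop :=
  ∀ (A : Type u) [Preorder A] [IsDirectedOrder A] [Nonempty A] (x : A → L),
    OrderConverges x 0 → OrderConverges (fun a => T (x a)) 0

/-- A band is an order closed ideal, i.e., an order closed solid linear subspace. -/
structure IsBand {L : Type u} [AddCommGroup L] [Lattice L] [Module ℝ L]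
    (B : Submodule ℝ L) : Prop where
  solid : ∀ ⦃x y : L⦄, x ∈ B → |y| ≤ |x| → y ∈ B
  orderClosed : IsOrderClosed (B : Set L)

/-- Every non-empty subset that is bounded above has a supremum. -/
def IsDedekindComplete (L : Type u) [Lattice L] : Prop :=
  ∀ s : Set L, s.Nonempty → BddAbove s → ∃ a, IsLUB s a

/-- A weak order unit: a positive element whose disjoint complement is trivial. -/
def IsWeakOrderUnit {L : Type u} [AddCommGroup L] [Lattice L] (e : L) : Prop :=
  0 ≤ e ∧ ∀ x : L, |x| ⊓ e = 0 → x = 0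

end OrderConvergence

/-! ### Vector sublattices -/

/-- A vector sublattice: a linear subspace that is closed under the lattice operations. -/
structure VectorSublattice (L : Type u) [AddCommGroup L] [Lattice L] [Module ℝ L] extends
    Submodule ℝ L where
  sup_mem' : ∀ {x y : L}, x ∈ carrier → y ∈ carrier → x ⊔ y ∈ carrier
  inf_mem' : ∀ {x y : L}, x ∈ carrier → y ∈ carrier → x ⊓ y ∈ carrier

namespace VectorSublattice

variable {L : Type u} [AddCommGroup L] [Lattice L] [Module ℝ L]

instance : SetLike (VectorSublattice L) L where
  coe F := F.carrier
  coe_injective F G h := by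
    cases F; cases G; congr; exact SetLike.coe_injective h

instance : AddSubgroupClass (VectorSublattice L) L where
  add_mem {F} _ _ hx hy := F.toSubmodule.add_mem hx hy
  zero_mem F := F.toSubmodule.zero_mem
  neg_mem {F} _ hx := F.toSubmodule.neg_mem hx

instance : SMulMemClass (VectorSublattice L) ℝ L where
  smul_mem {F} c _ hx := F.toSubmodule.smul_mem c hx

/-- A vector sublattice is a lattice for the restricted ordering; the lattice operations are
those of the surrounding space. -/
instance (F : VectorSublattice L) : Lattice F :=
  Subtype.lattice (fun _ _ hx hy => F.sup_mem' hx hy) (fun _ _ hx hy => F.inf_mem' hx hy)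

/-- A vector sublattice is regular when its inclusion map is order continuous. -/
def IsRegular (F : VectorSublattice L) : Prop :=
  IsOrderContinuous (SMulMemClass.subtype F : F →ₗ[ℝ] L)

/-- The part of a vector sublattice `C` in the vector sublattice `F`, as a vector sublattice of
`F`.  When `C ⊆ F`, this is `C`, viewed as a vector sublattice of `F`. -/
def within (C F : VectorSublattice L) : VectorSublattice F where
  carrier := {x | (x : L) ∈ C}
  add_mem' hx hy := add_mem (S := VectorSublattice L) hx hy
  zero_mem' := zero_mem C
  smul_mem' c _ hx := SMulMemClass.smul_mem (S := VectorSublattice L) c hx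
  sup_mem' hx hy := C.sup_mem' hx hy
  inf_mem' hx hy := C.inf_mem' hx hy

end VectorSublattice

/-- A vector lattice subalgebra: a vector sublattice that is closed under multiplication. -/
structure VectorLatticeSubalgebra (L : Type u) [Ring L] [Algebra ℝ L] [Lattice L] extends
    VectorSublattice L where
  mul_mem' : ∀ {x y : L}, x ∈ carrier → y ∈ carrier → x * y ∈ carrier

/-! ### The vector lattice algebra of order bounded operators -/

section OrderBounded

/-- The algebra of order bounded operators: the linear operators that map
order bounded sets to order bounded sets.  Multiplication is composition. -/
def orderBoundedOperators (E : Type u) [AddCommGroup E] [Lattice E] [IsOrderedAddMonoid E]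
    [Module ℝ E] [IsOrderedModule ℝ E] : Subalgebra ℝ (Module.End ℝ E) where
  carrier := {T | ∀ s : Set E, BddBelow s → BddAbove s → BddBelow (T '' s) ∧ BddAbove (T '' s)}
  mul_mem' {T S} hT hS s h₁ h₂ := by
    have h := hS s h₁ h₂
    have := hT _ h.1 h.2
    rwa [Set.image_image] at this
  add_mem' {T S} hT hS s h₁ h₂ := by
    obtain ⟨⟨a, ha⟩, ⟨b, hb⟩⟩ := hT s h₁ h₂
    obtain ⟨⟨c, hc⟩, ⟨d, hd⟩⟩ := hS s h₁ h₂
    refine ⟨⟨a + c, ?_⟩, ⟨b + d, ?_⟩⟩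
    · rintro _ ⟨x, hx, rfl⟩
      exact add_le_add (ha ⟨x, hx, rfl⟩) (hc ⟨x, hx, rfl⟩)
    · rintro _ ⟨x, hx, rfl⟩
      exact add_le_add (hb ⟨x, hx, rfl⟩) (hd ⟨x, hx, rfl⟩)
  algebraMap_mem' r s := by
    rintro ⟨a, ha⟩ ⟨b, hb⟩
    rcases le_total 0 r with hr | hr
    · refine ⟨⟨r • a, ?_⟩, ⟨r • b, ?_⟩⟩
      · rintro _ ⟨x, hx, rfl⟩
        exact smul_le_smul_of_nonneg_left (ha hx) hr
      · rintro _ ⟨x, hx, rfl⟩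
        exact smul_le_smul_of_nonneg_left (hb hx) hr
    · refine ⟨⟨r • b, ?_⟩, ⟨r • a, ?_⟩⟩
      · rintro _ ⟨x, hx, rfl⟩
        exact smul_le_smul_of_nonpos_left (hb hx) hr
      · rintro _ ⟨x, hx, rfl⟩
        exact smul_le_smul_of_nonpos_left (ha hx) hr

/-- A map that is additive and positively homogeneous on the positive cone extends
to a linear operator. -/
theorem exists_linear_extension {E : Type u} [AddCommGroup E] [Lattice E] [IsOrderedAddMonoid E]
    [Module ℝ E] [IsOrderedModule ℝ E] (p : E → E)
    (hadd : ∀ x y, 0 ≤ x → 0 ≤ y → p (x + y) = p x + p y)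
    (hsmul : ∀ (c : ℝ) x, 0 ≤ c → 0 ≤ x → p (c • x) = c • p x) :
    ∃ T : E →ₗ[ℝ] E, ∀ x, 0 ≤ x → T x = p x := by
  have key : ∀ x a b : E, 0 ≤ a → 0 ≤ b → x = a - b → p x⁺ - p x⁻ = p a - p b := by
    intro x a b ha hb h
    have h1 : x⁺ + b = a + x⁻ := by
      have := posPart_sub_negPart x
      rw [h] at this ⊢
      rw [← sub_eq_sub_iff_add_eq_add]
      exact this
    have h2 := hadd _ _ (posPart_nonneg x) hb
    rw [h1, hadd _ _ ha (negPart_nonneg x)] at h2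
    rw [sub_eq_sub_iff_add_eq_add]
    exact h2.symm
  have hp0 : p 0 = 0 := by simpa using hsmul 0 0 le_rfl le_rfl
  refine ⟨{ toFun := fun x => p x⁺ - p x⁻, map_add' := ?_, map_smul' := ?_ }, ?_⟩
  · intro x y
    rw [key (x + y) (x⁺ + y⁺) (x⁻ + y⁻) (add_nonneg (posPart_nonneg _) (posPart_nonneg _))
      (add_nonneg (negPart_nonneg _) (negPart_nonneg _)),
      hadd _ _ (posPart_nonneg _) (posPart_nonneg _),
      hadd _ _ (negPart_nonneg _) (negPart_nonneg _)]
    · abel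
    · conv_lhs => rw [← posPart_sub_negPart x, ← posPart_sub_negPart y]
      abel
  · intro c x
    simp only [RingHom.id_apply]
    rcases le_total 0 c with hc | hc
    · rw [key (c • x) (c • x⁺) (c • x⁻) (smul_nonneg hc (posPart_nonneg _))
        (smul_nonneg hc (negPart_nonneg _)), hsmul _ _ hc (posPart_nonneg _),
        hsmul _ _ hc (negPart_nonneg _), smul_sub]
      rw [← smul_sub, posPart_sub_negPart]
    · have hc' : 0 ≤ -c := neg_nonneg.2 hc
      rw [key (c • x) ((-c) • x⁻) ((-c) • x⁺) (smul_nonneg hc' (negPart_nonneg _))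
        (smul_nonneg hc' (posPart_nonneg _)), hsmul _ _ hc' (posPart_nonneg _),
        hsmul _ _ hc' (negPart_nonneg _)]
      · simp only [neg_smul, smul_sub]; abel
      · conv_lhs => rw [← posPart_sub_negPart x]
        simp only [neg_smul, smul_sub]; abel
  · intro x hx
    simp [posPart_eq_self.2 hx, negPart_eq_zero.2 hx, hp0]

variable {E : Type u} [AddCommGroup E] [ConditionallyCompleteLattice E] [IsOrderedAddMonoid E]
  [Module ℝ E] [IsOrderedModule ℝ E]

/-- The operator ordering: `T ≤ S` when `T x ≤ S x` for all `x ≥ 0`. -/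
instance : PartialOrder (orderBoundedOperators E) where
  le T S := ∀ x : E, 0 ≤ x → (T : Module.End ℝ E) x ≤ (S : Module.End ℝ E) x
  le_refl T x _ := le_rfl
  le_trans T S R h₁ h₂ x hx := (h₁ x hx).trans (h₂ x hx)
  le_antisymm T S h₁ h₂ := by
    have h : ∀ x : E, 0 ≤ x → (T : Module.End ℝ E) x = (S : Module.End ℝ E) x :=
      fun x hx => le_antisymm (h₁ x hx) (h₂ x hx)
    refine Subtype.ext (LinearMap.ext fun x => ?_)
    rw [← posPart_sub_negPart x, map_sub, map_sub, h _ (posPart_nonneg x),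
      h _ (negPart_nonneg x)]

/-- The Riesz-Kantorovich formula for the positive part. -/
theorem exists_operator_posPart (T : orderBoundedOperators E) :
    ∃ P : orderBoundedOperators E,
      (∀ x : E, 0 ≤ x → IsLUB ((T : Module.End ℝ E) '' Set.Icc 0 x) ((P : Module.End ℝ E) x)) := by
  have hne : ∀ x : E, 0 ≤ x → ((T : Module.End ℝ E) '' Set.Icc 0 x).Nonempty :=
    fun x hx => ⟨_, 0, ⟨le_rfl, hx⟩, rfl⟩
  have hbd : ∀ x : E, BddAbove ((T : Module.End ℝ E) '' Set.Icc 0 x) :=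
    fun x => (T.2 _ bddBelow_Icc bddAbove_Icc).2
  have hlub : ∀ x : E, 0 ≤ x → IsLUB ((T : Module.End ℝ E) '' Set.Icc 0 x)
    (sSup ((T : Module.End ℝ E) '' Set.Icc 0 x)) := fun x hx => isLUB_csSup (hne x hx) (hbd x)
  obtain ⟨P, hP⟩ := exists_linear_extension
    (fun x => sSup ((T : Module.End ℝ E) '' Set.Icc 0 x)) (by
      intro x y hx hy
      have hxy : 0 ≤ x + y := add_nonneg hx hy
      apply le_antisymm
      · apply csSup_le (hne _ hxy)
        rintro _ ⟨z, ⟨hz0, hz⟩, rfl⟩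
        have h1 : (T : Module.End ℝ E) z
            = (T : Module.End ℝ E) (z ⊓ x) + (T : Module.End ℝ E) (z - z ⊓ x) := by
          rw [← map_add]; congr 1; abel
        rw [h1]
        refine add_le_add (le_csSup (hbd x) ⟨_, ⟨le_inf hz0 hx, inf_le_right⟩, rfl⟩)
          (le_csSup (hbd y) ⟨_, ⟨sub_nonneg.2 inf_le_left, ?_⟩, rfl⟩)
        rw [sub_le_comm]
        exact le_inf (sub_le_self _ hy) (sub_le_iff_le_add.2 hz)
      · rw [← le_sub_iff_add_le]
        apply csSup_le (hne _ hx)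
        rintro _ ⟨z, ⟨hz0, hz⟩, rfl⟩
        rw [le_sub_comm]
        apply csSup_le (hne _ hy)
        rintro _ ⟨w, ⟨hw0, hw⟩, rfl⟩
        rw [le_sub_iff_add_le, ← map_add]
        refine le_csSup (hbd _) ⟨_, ⟨add_nonneg hw0 hz0, ?_⟩, rfl⟩
        rw [add_comm]
        exact add_le_add hz hw) (by
      have hle : ∀ (c : ℝ) (x : E), 0 < c → 0 ≤ x →
          c • sSup ((T : Module.End ℝ E) '' Set.Icc 0 x)
            ≤ sSup ((T : Module.End ℝ E) '' Set.Icc 0 (c • x)) := by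
        intro c x hc hx
        rw [← le_inv_smul_iff_of_pos hc]
        apply csSup_le (hne _ hx)
        rintro _ ⟨z, ⟨hz0, hz⟩, rfl⟩
        rw [le_inv_smul_iff_of_pos hc, ← map_smul]
        exact le_csSup (hbd _) ⟨_, ⟨smul_nonneg hc.le hz0,
          smul_le_smul_of_nonneg_left hz hc.le⟩, rfl⟩
      intro c x hc hx
      rcases hc.eq_or_lt with rfl | hc
      · simp
      · refine le_antisymm ?_ (hle c x hc hx)
        have := hle c⁻¹ (c • x) (inv_pos.2 hc) (smul_nonneg hc.le hx)
        rwa [inv_smul_smul₀ hc.ne', inv_smul_le_iff_of_pos hc] at this)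
  have hpos : ∀ x : E, 0 ≤ x → 0 ≤ P x := fun x hx => by
    rw [hP x hx]
    exact le_csSup (hbd x) ⟨0, ⟨le_rfl, hx⟩, map_zero _⟩
  have hmono : ∀ x y : E, x ≤ y → P x ≤ P y := fun x y h => by
    have := hpos (y - x) (sub_nonneg.2 h)
    rwa [map_sub, sub_nonneg] at this
  refine ⟨⟨P, ?_⟩, fun x hx => ?_⟩
  · rintro s ⟨a, ha⟩ ⟨b, hb⟩
    refine ⟨⟨P a, ?_⟩, ⟨P b, ?_⟩⟩
    · rintro _ ⟨x, hx, rfl⟩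
      exact hmono _ _ (ha hx)
    · rintro _ ⟨x, hx, rfl⟩
      exact hmono _ _ (hb hx)
  · change IsLUB _ (P x)
    rw [hP x hx]
    exact hlub x hx

/-- The positive part of an order bounded operator. -/
def operatorPosPart (T : orderBoundedOperators E) : orderBoundedOperators E :=
  (exists_operator_posPart T).choose

theorem operatorPosPart_isLUB (T : orderBoundedOperators E) (x : E) (hx : 0 ≤ x) :
    IsLUB ((T : Module.End ℝ E) '' Set.Icc 0 x) ((operatorPosPart T : Module.End ℝ E) x) :=
  (exists_operator_posPart T).choose_spec x hx

theorem operator_le_def (T S : orderBoundedOperators E) :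
    T ≤ S ↔ ∀ x : E, 0 ≤ x → (T : Module.End ℝ E) x ≤ (S : Module.End ℝ E) x :=
  Iff.rfl

instance : IsOrderedAddMonoid (orderBoundedOperators E) where
  add_le_add_left T S h R x hx := by
    exact add_le_add_left (h x hx) _

instance : IsOrderedModule ℝ (orderBoundedOperators E) :=
  .of_smul_nonneg fun c hc T hT x hx => by
    exact smul_nonneg hc (hT x hx)

theorem le_operatorPosPart (T : orderBoundedOperators E) : T ≤ operatorPosPart T :=
  fun x hx => (operatorPosPart_isLUB T x hx).1 ⟨x, ⟨hx, le_rfl⟩, rfl⟩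

theorem operatorPosPart_nonneg (T : orderBoundedOperators E) : 0 ≤ operatorPosPart T :=
  fun x hx => (operatorPosPart_isLUB T x hx).1 ⟨0, ⟨le_rfl, hx⟩, map_zero _⟩

theorem operatorPosPart_le {T R : orderBoundedOperators E} (h : T ≤ R) (h0 : 0 ≤ R) :
    operatorPosPart T ≤ R := by
  intro x hx
  refine (operatorPosPart_isLUB T x hx).2 ?_
  rintro _ ⟨y, ⟨hy0, hy⟩, rfl⟩
  refine (h y hy0).trans ?_
  have h1 : 0 ≤ (R : Module.End ℝ E) (x - y) := h0 (x - y) (sub_nonneg.2 hy)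
  rw [map_sub] at h1
  exact sub_nonneg.1 h1

/-- The order bounded operators on a Dedekind complete vector lattice form a lattice for the
operator ordering. -/
instance : Lattice (orderBoundedOperators E) where
  sup T S := operatorPosPart (T - S) + S
  inf T S := T - operatorPosPart (T - S)
  le_sup_left _ _ := sub_le_iff_le_add.1 (le_operatorPosPart _)
  le_sup_right _ _ := le_add_of_nonneg_left (operatorPosPart_nonneg _)
  sup_le _ S _ h₁ h₂ := le_sub_iff_add_le.1
    (operatorPosPart_le (sub_le_sub_right h₁ S) (sub_nonneg.2 h₂))
  inf_le_left _ _ := sub_le_self _ (operatorPosPart_nonneg _)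
  inf_le_right _ _ := sub_le_comm.1 (le_operatorPosPart _)
  le_inf _ T _ h₁ h₂ := le_sub_comm.1
    (operatorPosPart_le (sub_le_sub_left h₂ T) (sub_nonneg.2 h₁))

theorem operator_sup_def (T S : orderBoundedOperators E) :
    T ⊔ S = operatorPosPart (T - S) + S := rfl

theorem operator_inf_def (T S : orderBoundedOperators E) :
    T ⊓ S = T - operatorPosPart (T - S) := rfl

/-! ### Orthomorphisms -/

/-- A supremum of elements of a band belongs to the band. -/
theorem IsBand.isLUB_mem {B : Submodule ℝ E} (hB : IsBand B) {s : Set E} (hs : s.Nonempty)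
    (hsB : s ⊆ B) {l : E} (hl : IsLUB s l) : l ∈ B := by
  classical
  have hsup : ∀ x y : E, x ∈ B → y ∈ B → x ⊔ y ∈ B := by
    intro x y hx hy
    have h1 : (x - y)⁺ ∈ B := hB.solid (B.sub_mem hx hy) (by
      rw [abs_of_nonneg (posPart_nonneg _)]
      exact sup_le (le_abs_self _) (abs_nonneg _))
    rw [sup_eq_add_posPart_sub]
    exact B.add_mem hy h1
  have hfin : ∀ t : {t : Finset E // t.Nonempty ∧ (t : Set E) ⊆ s}, t.1.sup' t.2.1 id ∈ B := by
    intro t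
    exact Finset.sup'_mem (B : Set E) (fun x hx y hy => hsup x y hx hy) _ _ _
      (fun i hi => hsB (t.2.2 hi))
  have hmem : l ∈ orderAdherence (B : Set E) := by
    obtain ⟨a, ha⟩ := hs
    refine ⟨{t : Finset E // t.Nonempty ∧ (t : Set E) ⊆ s}, inferInstance, ⟨?_⟩,
      ⟨{a}, by simp, by simpa using ha⟩, fun t => t.1.sup' t.2.1 id, hfin, ?_⟩
    · rintro ⟨t, ht, hts⟩ ⟨r, hr, hrs⟩
      refine ⟨⟨t ∪ r, ht.mono Finset.subset_union_left, by
        simpa using And.intro hts hrs⟩, ?_, ?_⟩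
      · exact Finset.subset_union_left
      · exact Finset.subset_union_right
    · refine ⟨{t : Finset E // t.Nonempty ∧ (t : Set E) ⊆ s}, inferInstance, ⟨?_⟩,
        ⟨{a}, by simp, by simpa using ha⟩, fun t => l - t.1.sup' t.2.1 id, ?_, ⟨?_, ?_⟩, ?_⟩
      · rintro ⟨t, ht, hts⟩ ⟨r, hr, hrs⟩
        refine ⟨⟨t ∪ r, ht.mono Finset.subset_union_left, by
          simpa using And.intro hts hrs⟩, ?_, ?_⟩
        · exact Finset.subset_union_left
        · exact Finset.subset_union_right
      · intro t r h
        exact sub_le_sub_left (Finset.sup'_mono _ h _) _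
      · rintro _ ⟨t, rfl⟩
        exact sub_nonneg.2 (Finset.sup'_le _ _ fun x hx => hl.1 (t.2.2 hx))
      · intro b hb
        have : l ≤ l - b := hl.2 (by
          intro x hx
          have := hb ⟨⟨{x}, by simp, by simpa using hx⟩, rfl⟩
          simp only [Finset.sup'_singleton, id] at this
          exact le_sub_comm.1 this)
        simpa using this
      · intro t
        refine ⟨t, fun r h => ?_⟩
        change |l - r.1.sup' r.2.1 id| ≤ l - t.1.sup' t.2.1 id
        have h0 : 0 ≤ l - r.1.sup' r.2.1 id :=
          sub_nonneg.2 (Finset.sup'_le _ _ fun x hx => hl.1 (r.2.2 hx))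
        rw [abs_of_nonneg h0]
        exact sub_le_sub_left (Finset.sup'_mono _ h _) _
  rwa [hB.orderClosed] at hmem

variable (E) in
/-- The orthomorphisms: the order bounded operators that leave every band invariant.  They
form a vector lattice subalgebra of the order bounded operators. -/
def orthomorphisms : VectorLatticeSubalgebra (orderBoundedOperators E) :=
  have hadd : ∀ {T S : orderBoundedOperators E},
      (∀ B : Submodule ℝ E, IsBand B → ∀ x ∈ B, (T : Module.End ℝ E) x ∈ B) →
      (∀ B : Submodule ℝ E, IsBand B → ∀ x ∈ B, (S : Module.End ℝ E) x ∈ B) →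
      (∀ B : Submodule ℝ E, IsBand B → ∀ x ∈ B, ((T + S : orderBoundedOperators E) :
        Module.End ℝ E) x ∈ B) :=
    fun hT hS B hB x hx => B.add_mem (hT B hB x hx) (hS B hB x hx)
  have hsub : ∀ {T S : orderBoundedOperators E},
      (∀ B : Submodule ℝ E, IsBand B → ∀ x ∈ B, (T : Module.End ℝ E) x ∈ B) →
      (∀ B : Submodule ℝ E, IsBand B → ∀ x ∈ B, (S : Module.End ℝ E) x ∈ B) →
      (∀ B : Submodule ℝ E, IsBand B → ∀ x ∈ B, ((T - S : orderBoundedOperators E) :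
        Module.End ℝ E) x ∈ B) :=
    fun hT hS B hB x hx => B.sub_mem (hT B hB x hx) (hS B hB x hx)
  have hpos : ∀ {T : orderBoundedOperators E},
      (∀ B : Submodule ℝ E, IsBand B → ∀ x ∈ B, (T : Module.End ℝ E) x ∈ B) →
      (∀ B : Submodule ℝ E, IsBand B → ∀ x ∈ B, (operatorPosPart T : Module.End ℝ E) x ∈ B) := by
    intro T hT B hB
    have h0 : ∀ x ∈ B, 0 ≤ x → (operatorPosPart T : Module.End ℝ E) x ∈ B := by
      intro x hx hx0
      have hne : (Set.Icc 0 x).Nonempty := ⟨0, le_rfl, hx0⟩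
      refine hB.isLUB_mem (hne.image _) ?_ (operatorPosPart_isLUB T x hx0)
      rintro _ ⟨y, ⟨hy0, hy⟩, rfl⟩
      exact hT B hB y (hB.solid hx (by rwa [abs_of_nonneg hy0, abs_of_nonneg hx0]))
    intro x hx
    rw [← posPart_sub_negPart x, map_sub]
    refine B.sub_mem (h0 _ (hB.solid hx ?_) (posPart_nonneg x))
      (h0 _ (hB.solid hx ?_) (negPart_nonneg x))
    · rw [abs_of_nonneg (posPart_nonneg _)]
      exact sup_le (le_abs_self _) (abs_nonneg _)
    · rw [abs_of_nonneg (negPart_nonneg _)]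
      exact sup_le (neg_le_abs _) (abs_nonneg _)
  { carrier := {T | ∀ B : Submodule ℝ E, IsBand B → ∀ x ∈ B, (T : Module.End ℝ E) x ∈ B}
    add_mem' := hadd
    zero_mem' := fun B _ _ _ => B.zero_mem
    smul_mem' := fun c _ hT B hB x hx => B.smul_mem c (hT B hB x hx)
    sup_mem' := fun hT hS => hadd (hpos (hsub hT hS)) hS
    inf_mem' := fun hT hS => hsub hT (hpos (hsub hT hS))
    mul_mem' := fun hT hS B hB x hx => hT B hB _ (hS B hB x hx) }

/-- The commutant in the orthomorphisms of a set of order bounded operators. -/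
def orthCommutant (𝒮 : Set (orderBoundedOperators E)) : Set (orderBoundedOperators E) :=
  {T | T ∈ (orthomorphisms E).toVectorSublattice ∧ ∀ S ∈ 𝒮, T * S = S * T}

end OrderBounded

end

/-!
The commutant is visibly a subalgebra of the orthomorphisms that contains the identity, so the
issue is its stability under the lattice operations, which reduces to the following: if an
orthomorphism `T` commutes with a positive operator `S`, then so does its positive part `A`
(`operatorPosPart_mul_comm`).  Put `B = A - T`.  For orthomorphisms, `A y ⊓ B y = 0` for `0 ≤ y`
(`operatorPosPart_inf_negPart_apply`), whence `B A = 0`.  This implies that `D = S A - A S` is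
positive and vanishes on the range of `A`.  For `0 ≤ x`, the operator `R = 1 - n A` yields an
element `u = R⁺ x` such that `n A u ≤ u ≤ x ≤ u + n A x`.  Hence
`n D x ≤ n D u ≤ n S A u ≤ S x` for all `n`, and `D x = 0` since `E` is Archimedean.

The identity is a weak order unit because an orthomorphism `R ≥ 0` that is disjoint from the
identity satisfies `R x ⊓ x = 0` for `0 ≤ x`, whereas `R x` is in the band generated by `x`.

The three remaining statements rest on the commutant being closed under order limits in the space
of order bounded operators (`mem_orthCommutant_of_orderConverges`).  This holds because infima of
decreasing nets of positive operators are pointwise infima on the positive cone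
(`exists_operator_isGLB`), so order convergence of operators implies pointwise order convergence;
composition with an order continuous operator from the left then preserves the limits.
-/

noncomputable section

/-! ### Lattice-ordered groups and vector lattices -/

section VectorLattice

theorem add_inf_le_of_nonneg {L : Type u} [AddCommGroup L] [Lattice L] [IsOrderedAddMonoid L]
    {a b c : L} (ha : 0 ≤ a) (hb : 0 ≤ b) (hc : 0 ≤ c) : (a + b) ⊓ c ≤ a ⊓ c + b ⊓ c := by
  have h1 : (a + b) ⊓ c - a ≤ b ⊓ c :=
    le_inf (sub_le_iff_le_add'.2 inf_le_left) ((sub_le_self _ ha).trans inf_le_right)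
  have h2 : (a + b) ⊓ c - b ⊓ c ≤ a ⊓ c :=
    le_inf (sub_le_comm.1 h1) ((sub_le_self _ (le_inf hb hc)).trans inf_le_right)
  exact sub_le_iff_le_add.1 h2

/-- Conditionally complete lattice-ordered groups are Archimedean. -/
theorem nonpos_of_forall_nsmul_le {L : Type u} [AddCommGroup L] [ConditionallyCompleteLattice L]
    [IsOrderedAddMonoid L] {a b : L} (h : ∀ n : ℕ, n • a ≤ b) : a ≤ 0 := by
  have hbd : BddAbove (Set.range fun n : ℕ => n • a) := ⟨b, by rintro _ ⟨n, rfl⟩; exact h n⟩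
  have h1 : (⨆ n : ℕ, n • a) ≤ (⨆ n : ℕ, n • a) - a := by
    refine ciSup_le fun n => le_sub_iff_add_le.2 ?_
    rw [← succ_nsmul]
    exact le_ciSup hbd (n + 1)
  simpa using h1

theorem isGLB_range_add_of_antitone {L : Type u} [AddCommGroup L] [Lattice L]
    [IsOrderedAddMonoid L] {B : Type v} [Preorder B] [IsDirectedOrder B] {f g : B → L} {a b : L}
    (hf : Antitone f) (hg : Antitone g) (ha : IsGLB (Set.range f) a)
    (hb : IsGLB (Set.range g) b) : IsGLB (Set.range fun i => f i + g i) (a + b) := by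
  refine ⟨?_, fun l hl => ?_⟩
  · rintro _ ⟨i, rfl⟩
    exact add_le_add (ha.1 ⟨i, rfl⟩) (hb.1 ⟨i, rfl⟩)
  · have h1 : l - a ≤ b := by
      refine hb.2 ?_
      rintro _ ⟨j, rfl⟩
      refine sub_le_comm.1 (ha.2 ?_)
      rintro _ ⟨i, rfl⟩
      obtain ⟨k, hik, hjk⟩ := exists_ge_ge i j
      exact sub_le_iff_le_add.2 ((hl ⟨k, rfl⟩).trans (add_le_add (hf hik) (hg hjk)))
    exact sub_le_iff_le_add'.1 h1

theorem isGLB_range_smul {L : Type u} [AddCommGroup L] [Lattice L] [IsOrderedAddMonoid L]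
    [Module ℝ L] [IsOrderedModule ℝ L] {B : Type v} [Nonempty B] {f : B → L} {a : L} {c : ℝ}
    (hc : 0 ≤ c) (ha : IsGLB (Set.range f) a) : IsGLB (Set.range fun i => c • f i) (c • a) := by
  rcases hc.eq_or_lt with rfl | hc'
  · simp
  · refine ⟨?_, fun l hl => ?_⟩
    · rintro _ ⟨i, rfl⟩
      exact smul_le_smul_of_nonneg_left (ha.1 ⟨i, rfl⟩) hc
    · rw [← inv_smul_le_iff_of_pos hc']
      refine ha.2 ?_
      rintro _ ⟨i, rfl⟩
      exact (inv_smul_le_iff_of_pos hc').2 (hl ⟨i, rfl⟩)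

theorem IsDedekindComplete.exists_isGLB {L : Type u} [AddCommGroup L] [Lattice L]
    [IsOrderedAddMonoid L] (hL : IsDedekindComplete L) {s : Set L} (hs : s.Nonempty)
    (hb : BddBelow s) : ∃ a, IsGLB s a := by
  obtain ⟨a, ha⟩ := hL (-s) hs.neg hb.neg
  exact ⟨-a, by simpa using ha.neg⟩

end VectorLattice

/-! ### Order convergence -/

section OrderConvergence

variable {L : Type u} [AddCommGroup L] [Lattice L]

theorem OrderConverges.neg {A : Type v} [Preorder A] {x : A → L} (h : OrderConverges x 0) :
    OrderConverges (fun a => -x a) 0 := by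
  obtain ⟨B, i1, i2, i3, y, h1, h2, h3⟩ := h
  refine ⟨B, i1, i2, i3, y, h1, h2, fun b => (h3 b).imp fun a₀ ha a haa => ?_⟩
  have := ha a haa
  rwa [zero_sub, neg_neg, ← abs_neg, ← zero_sub]

theorem IsOrderContinuous.neg [Module ℝ L] {M : Type v} [AddCommGroup M] [Lattice M] [Module ℝ M]
    {T : L →ₗ[ℝ] M} (h : IsOrderContinuous T) : IsOrderContinuous (-T) := by
  intro A _ _ _ x hx
  exact (h A x hx).neg

/-- An order convergent net `x` with limit `l` in a regular vector sublattice order converges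
to `l` in the surrounding vector lattice. -/
theorem VectorSublattice.IsRegular.orderConverges_coe [Module ℝ L] {F : VectorSublattice L}
    (hF : F.IsRegular) {A : Type u} [Preorder A] [IsDirectedOrder A] [Nonempty A] {x : A → F}
    {l : F} (h : OrderConverges x l) : OrderConverges (fun a => (x a : L)) (l : L) := by
  have h0 : OrderConverges (fun a => x a - l) 0 := by
    obtain ⟨B, i1, i2, i3, y, h1, h2, h3⟩ := h
    refine ⟨B, i1, i2, i3, y, h1, h2, fun b => (h3 b).imp fun a₀ ha a haa => ?_⟩
    have := ha a haa
    rwa [zero_sub, neg_sub]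
  obtain ⟨B, i1, i2, i3, y, h1, h2, h3⟩ := hF A _ h0
  refine ⟨B, i1, i2, i3, y, h1, h2, fun b => (h3 b).imp fun a₀ ha a haa => ?_⟩
  have := ha a haa
  change |(0 : L) - ((x a : L) - (l : L))| ≤ y b at this
  rwa [zero_sub, neg_sub] at this

variable [IsOrderedAddMonoid L]

theorem subset_orderAdherence (s : Set L) : s ⊆ orderAdherence s := by
  intro x hx
  refine ⟨PUnit, inferInstance, inferInstance, inferInstance, fun _ => x, fun _ => hx, PUnit,
    inferInstance, inferInstance, inferInstance, fun _ => 0, fun _ _ _ => le_rfl, ?_,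
    fun _ => ⟨PUnit.unit, fun _ _ => by simp⟩⟩
  simp

theorem orderConverges_of_antitone {A : Type u} [Preorder A] [IsDirectedOrder A] [Nonempty A]
    {x : A → L} {l : L} (hx : Antitone x) (hl : IsGLB (Set.range x) l) : OrderConverges x l := by
  refine ⟨A, inferInstance, inferInstance, inferInstance, fun a => x a - l,
    fun a b h => sub_le_sub_right (hx h) _, ⟨?_, fun m hm => ?_⟩, fun b => ⟨b, fun a h => ?_⟩⟩
  · rintro _ ⟨a, rfl⟩
    exact sub_nonneg.2 (hl.1 ⟨a, rfl⟩)
  · have h1 : m + l ≤ l := hl.2 (by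
      rintro _ ⟨a, rfl⟩
      exact le_sub_iff_add_le.1 (hm ⟨a, rfl⟩))
    simpa using h1
  · rw [abs_sub_comm, abs_of_nonneg (sub_nonneg.2 (hl.1 ⟨a, rfl⟩))]
    exact sub_le_sub_right (hx h) _

theorem IsOrderContinuous.isGLB_range [Module ℝ L] {M : Type v} [AddCommGroup M] [Lattice M]
    [IsOrderedAddMonoid M] [Module ℝ M] {T : L →ₗ[ℝ] M} (hT : IsOrderContinuous T)
    (hpos : ∀ x, 0 ≤ x → 0 ≤ T x) {A : Type u} [Preorder A] [IsDirectedOrder A] [Nonempty A]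
    {x : A → L} (hx : Antitone x) (h0 : IsGLB (Set.range x) 0) :
    IsGLB (Set.range fun a => T (x a)) 0 := by
  obtain ⟨B, _, _, _, y, -, hy, hle⟩ := hT A x (orderConverges_of_antitone hx h0)
  refine ⟨?_, fun m hm => hy.2 ?_⟩
  · rintro _ ⟨a, rfl⟩
    exact hpos _ (h0.1 ⟨a, rfl⟩)
  · rintro _ ⟨b, rfl⟩
    obtain ⟨a, ha⟩ := hle b
    refine (hm ⟨a, rfl⟩).trans ((le_abs_self _).trans ?_)
    simpa using ha a le_rfl

end OrderConvergence

/-- An order closed vector sublattice of a Dedekind complete vector lattice is regular. -/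
theorem VectorSublattice.isRegular_of_isOrderClosed {L : Type u} [AddCommGroup L] [Lattice L]
    [IsOrderedAddMonoid L] [Module ℝ L] (hL : IsDedekindComplete L) {C : VectorSublattice L}
    (hC : IsOrderClosed (C : Set L)) : C.IsRegular := by
  rintro A _ _ _ x ⟨B, i1, i2, i3, y, hy, hy0, hle⟩
  have hanti : Antitone fun b => (y b : L) := fun b c h => hy h
  have hbelow : 0 ∈ lowerBounds (Set.range fun b => (y b : L)) := by
    rintro _ ⟨b, rfl⟩
    exact hy0.1 ⟨b, rfl⟩
  obtain ⟨g, hg⟩ := hL.exists_isGLB (Set.range_nonempty fun b => (y b : L)) ⟨0, hbelow⟩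
  have hgC : g ∈ C := by
    have h1 : g ∈ orderAdherence (C : Set L) :=
      ⟨B, i1, i2, i3, fun b => y b, fun b => (y b).2, orderConverges_of_antitone hanti hg⟩
    rwa [hC] at h1
  have hg0 : (⟨g, hgC⟩ : C) ≤ 0 := hy0.2 (by
    rintro _ ⟨b, rfl⟩
    exact hg.1 ⟨b, rfl⟩)
  have hg1 : g = 0 := le_antisymm hg0 (hg.2 hbelow)
  refine ⟨B, i1, i2, i3, fun b => y b, hanti, hg1 ▸ hg, fun b => (hle b).imp fun a₀ ha a haa => ?_⟩
  exact ha a haa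

/-! ### Disjoint complements -/

section Disjoint

variable {L : Type u} [AddCommGroup L] [Lattice L] [IsOrderedAddMonoid L] [Module ℝ L]
  [IsOrderedModule ℝ L]

/-- The disjoint complement `{x | |x| ⊓ |v| = 0}` of an element `v`. -/
def disjointComplement (v : L) : Submodule ℝ L where
  carrier := {x | |x| ⊓ |v| = 0}
  add_mem' {x y} hx hy := by
    refine le_antisymm ?_ (le_inf (abs_nonneg _) (abs_nonneg _))
    calc |x + y| ⊓ |v| ≤ (|x| + |y|) ⊓ |v| := inf_le_inf_right _ (abs_add_le x y)
      _ ≤ |x| ⊓ |v| + |y| ⊓ |v| :=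
        add_inf_le_of_nonneg (abs_nonneg _) (abs_nonneg _) (abs_nonneg _)
      _ = 0 := by rw [hx, hy, add_zero]
  zero_mem' := by
    change |(0 : L)| ⊓ |v| = 0
    rw [abs_zero, inf_eq_left]
    exact abs_nonneg _
  smul_mem' c x hx := by
    refine le_antisymm ?_ (le_inf (abs_nonneg _) (abs_nonneg _))
    have hk : 0 < |c| + 1 := by positivity
    have h1 : |c • x| ≤ (|c| + 1) • |x| := by
      have hx0 := abs_nonneg x
      refine le_trans (b := |c| • |x|) (sup_le ?_ ?_)
        (smul_le_smul_of_nonneg_right (by simp) hx0)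
      · rcases le_total 0 c with hc | hc
        · rw [abs_of_nonneg hc]
          exact smul_le_smul_of_nonneg_left (le_abs_self x) hc
        · rw [abs_of_nonpos hc, ← neg_smul_neg c x]
          exact smul_le_smul_of_nonneg_left (neg_le_abs x) (neg_nonneg.2 hc)
      · rcases le_total 0 c with hc | hc
        · rw [abs_of_nonneg hc, ← smul_neg]
          exact smul_le_smul_of_nonneg_left (neg_le_abs x) hc
        · rw [abs_of_nonpos hc, ← neg_smul]
          exact smul_le_smul_of_nonneg_left (le_abs_self x) (neg_nonneg.2 hc)
    have h2 : |v| ≤ (|c| + 1) • |v| := by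
      have : (1 : ℝ) • |v| ≤ (|c| + 1) • |v| :=
        smul_le_smul_of_nonneg_right (by simp) (abs_nonneg v)
      rwa [one_smul] at this
    have h3 : (|c| + 1)⁻¹ • (|c • x| ⊓ |v|) ≤ |x| ⊓ |v| :=
      le_inf ((inv_smul_le_iff_of_pos hk).2 (inf_le_left.trans h1))
        ((inv_smul_le_iff_of_pos hk).2 (inf_le_right.trans h2))
    have hx' : |x| ⊓ |v| = 0 := hx
    rw [hx', inv_smul_le_iff_of_pos hk, smul_zero] at h3
    exact h3

theorem mem_disjointComplement {v x : L} : x ∈ disjointComplement v ↔ |x| ⊓ |v| = 0 := Iff.rfl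

theorem isBand_disjointComplement (v : L) : IsBand (disjointComplement v) where
  solid x y hx h := le_antisymm ((inf_le_inf_right _ h).trans hx.le)
    (le_inf (abs_nonneg _) (abs_nonneg _))
  orderClosed := by
    refine Set.Subset.antisymm ?_ (subset_orderAdherence _)
    rintro l ⟨A, _, _, _, x, hx, B, _, _, _, y, -, hy, hle⟩
    refine le_antisymm (hy.2 ?_) (le_inf (abs_nonneg _) (abs_nonneg _))
    rintro _ ⟨b, rfl⟩
    obtain ⟨a, ha⟩ := hle b
    have hl : |l| ≤ |l - x a| + |x a| := by simpa using abs_add_le (l - x a) (x a)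
    calc |l| ⊓ |v| ≤ (|l - x a| + |x a|) ⊓ |v| := inf_le_inf_right _ hl
      _ ≤ |l - x a| ⊓ |v| + |x a| ⊓ |v| :=
        add_inf_le_of_nonneg (abs_nonneg _) (abs_nonneg _) (abs_nonneg _)
      _ = |l - x a| ⊓ |v| := by rw [mem_disjointComplement.1 (hx a), add_zero]
      _ ≤ y b := inf_le_left.trans (ha a le_rfl)

end Disjoint

variable {E : Type u} [AddCommGroup E] [ConditionallyCompleteLattice E] [IsOrderedAddMonoid E]
  [Module ℝ E] [IsOrderedModule ℝ E]

/-! ### Positive parts of orthomorphisms -/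

section Orthomorphisms

theorem one_mem_orthomorphisms : 1 ∈ (orthomorphisms E).toVectorSublattice :=
  fun _ _ _ hx => hx

theorem apply_le_apply_of_nonneg {T : orderBoundedOperators E} (hT : 0 ≤ T) {x y : E}
    (h : x ≤ y) : T.1 x ≤ T.1 y := by
  have h1 : 0 ≤ T.1 (y - x) := hT _ (sub_nonneg.2 h)
  rwa [map_sub, sub_nonneg] at h1

theorem operatorPosPart_mem_orthomorphisms {T : orderBoundedOperators E}
    (hT : T ∈ (orthomorphisms E).toVectorSublattice) :
    operatorPosPart T ∈ (orthomorphisms E).toVectorSublattice := by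
  have h := (orthomorphisms E).toVectorSublattice.sup_mem' hT
    (zero_mem (orthomorphisms E).toVectorSublattice)
  rwa [operator_sup_def, sub_zero, add_zero] at h

theorem disjoint_apply_left {T : orderBoundedOperators E}
    (hT : T ∈ (orthomorphisms E).toVectorSublattice) {x y : E} (h : |x| ⊓ |y| = 0) :
    |T.1 x| ⊓ |y| = 0 :=
  hT _ (isBand_disjointComplement y) x h

theorem disjoint_apply_apply {T S : orderBoundedOperators E}
    (hT : T ∈ (orthomorphisms E).toVectorSublattice)
    (hS : S ∈ (orthomorphisms E).toVectorSublattice) {x y : E} (h : |x| ⊓ |y| = 0) :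
    |T.1 x| ⊓ |S.1 y| = 0 := by
  rw [inf_comm]
  refine disjoint_apply_left hS ?_
  rw [inf_comm]
  exact disjoint_apply_left hT h

/-- The image of `x` under an orthomorphism is in the band generated by `x`, so that it cannot
be disjoint from `x` unless it vanishes. -/
theorem apply_eq_zero_of_disjoint {T : orderBoundedOperators E}
    (hT : T ∈ (orthomorphisms E).toVectorSublattice) {x : E} (h : |T.1 x| ⊓ |x| = 0) :
    T.1 x = 0 := by
  have h1 : |T.1 x| ⊓ |T.1 x| = 0 := disjoint_apply_left hT (by rwa [inf_comm])
  rw [inf_idem] at h1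
  exact le_antisymm ((le_abs_self _).trans h1.le) (neg_nonpos.1 ((neg_le_abs _).trans h1.le))

/-- The positive and negative parts of an orthomorphism are pointwise disjoint. -/
theorem operatorPosPart_inf_negPart_apply {T : orderBoundedOperators E}
    (hT : T ∈ (orthomorphisms E).toVectorSublattice) {y : E} (hy : 0 ≤ y) :
    (operatorPosPart T).1 y ⊓ (operatorPosPart T - T).1 y = 0 := by
  set A := operatorPosPart T with hA
  set B := A - T with hB
  have hA0 : 0 ≤ A := operatorPosPart_nonneg T
  have hB0 : 0 ≤ B := sub_nonneg.2 (le_operatorPosPart T)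
  have hAo := operatorPosPart_mem_orthomorphisms hT
  have hBo : B ∈ (orthomorphisms E).toVectorSublattice := sub_mem hAo hT
  set w := A.1 y ⊓ B.1 y with hw
  have hw0 : 0 ≤ w := le_inf (hA0 y hy) (hB0 y hy)
  -- For `0 ≤ z ≤ y`, the elements `A ((y - z) - z)⁻` and `B ((y - z) - z)⁺` are disjoint, and
  -- they dominate `w - 2 A (y - z)` and `w - 2 B z`, respectively.
  have key : ∀ z, 0 ≤ z → z ≤ y → w ≤ (2 : ℕ) • (A.1 (y - z) + B.1 z) := by
    intro z hz hzy
    have hAz : 0 ≤ A.1 (y - z) := hA0 _ (sub_nonneg.2 hzy)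
    have hBz : 0 ≤ B.1 z := hB0 _ hz
    set d := (y - z) - z with hd
    have hdis : |d⁻| ⊓ |d⁺| = 0 := by
      rw [abs_of_nonneg (posPart_nonneg d), abs_of_nonneg (negPart_nonneg d), inf_comm]
      exact posPart_inf_negPart_eq_zero d
    have hdis' := disjoint_apply_apply hAo hBo hdis
    rw [abs_of_nonneg (hA0 _ (negPart_nonneg d)), abs_of_nonneg (hB0 _ (posPart_nonneg d))]
      at hdis'
    have h1 : A.1 y - (2 : ℕ) • A.1 (y - z) ≤ A.1 d⁻ := by
      rw [← map_nsmul, ← map_sub]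
      refine apply_le_apply_of_nonneg hA0 ?_
      have : y - (2 : ℕ) • (y - z) = -d := by rw [hd, two_nsmul]; abel
      rw [this]
      exact neg_le_negPart d
    have h2 : B.1 y - (2 : ℕ) • B.1 z ≤ B.1 d⁺ := by
      rw [← map_nsmul, ← map_sub]
      refine apply_le_apply_of_nonneg hB0 ?_
      have : y - (2 : ℕ) • z = d := by rw [hd, two_nsmul]; abel
      rw [this]
      exact le_posPart d
    rw [← sub_nonpos, ← hdis', nsmul_add]
    refine le_inf (le_trans ?_ h1) (le_trans ?_ h2)
    · exact sub_le_sub inf_le_left (le_add_of_nonneg_right (nsmul_nonneg hBz 2))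
    · exact sub_le_sub inf_le_right (le_add_of_nonneg_left (nsmul_nonneg hAz 2))
  -- The Riesz-Kantorovich formula says that the infimum of `A (y - z) + B z` over `z` vanishes.
  have h4 : A.1 y ≤ A.1 y - (2 : ℝ)⁻¹ • w := by
    refine (operatorPosPart_isLUB T y hy).2 ?_
    rintro _ ⟨z, ⟨hz, hzy⟩, rfl⟩
    have h5 := key z hz hzy
    rw [← Nat.cast_smul_eq_nsmul ℝ, Nat.cast_ofNat, ← inv_smul_le_iff_of_pos two_pos] at h5
    rw [le_sub_comm]
    refine h5.trans (le_of_eq ?_)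
    have : B.1 z = A.1 z - T.1 z := rfl
    rw [this, map_sub]
    abel
  have h6 : (2 : ℝ)⁻¹ • w ≤ 0 := by simpa using h4
  rw [inv_smul_le_iff_of_pos two_pos, smul_zero] at h6
  exact le_antisymm h6 hw0

theorem negPart_operatorPosPart_apply {T : orderBoundedOperators E}
    (hT : T ∈ (orthomorphisms E).toVectorSublattice) {x : E} (hx : 0 ≤ x) :
    (operatorPosPart T - T).1 ((operatorPosPart T).1 x) = 0 := by
  have hA0 : 0 ≤ operatorPosPart T := operatorPosPart_nonneg T
  have hB0 : 0 ≤ operatorPosPart T - T := sub_nonneg.2 (le_operatorPosPart T)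
  have hBo : operatorPosPart T - T ∈ (orthomorphisms E).toVectorSublattice :=
    sub_mem (operatorPosPart_mem_orthomorphisms hT) hT
  have hy := hA0 x hx
  set y := (operatorPosPart T).1 x with hydef
  change 0 ≤ y at hy
  refine apply_eq_zero_of_disjoint hBo ?_
  rw [abs_of_nonneg (hB0 y hy), abs_of_nonneg hy]
  refine le_antisymm ?_ (le_inf (hB0 y hy) hy)
  -- Both elements are dominated by the values at `x + y` of the parts of `T`.
  rw [← operatorPosPart_inf_negPart_apply hT (add_nonneg hx hy), inf_comm]
  exact inf_le_inf (apply_le_apply_of_nonneg hA0 (le_add_of_nonneg_right hy))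
    (apply_le_apply_of_nonneg hB0 (le_add_of_nonneg_left hx))

theorem operatorPosPart_apply_eq {T : orderBoundedOperators E}
    (hT : T ∈ (orthomorphisms E).toVectorSublattice) {y : E} (hy : 0 ≤ y) (h : 0 ≤ T.1 y) :
    (operatorPosPart T).1 y = T.1 y := by
  have h1 : (operatorPosPart T - T).1 y = (operatorPosPart T).1 y - T.1 y := rfl
  have h2 := operatorPosPart_inf_negPart_apply hT hy
  rw [inf_eq_right.2 (by rw [h1]; exact sub_le_self _ h), h1] at h2
  exact sub_eq_zero.1 h2

/-- If an orthomorphism commutes with a positive operator, then so does its positive part. -/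
theorem operatorPosPart_mul_comm {T S : orderBoundedOperators E}
    (hT : T ∈ (orthomorphisms E).toVectorSublattice) (hS : 0 ≤ S) (h : T * S = S * T) :
    operatorPosPart T * S = S * operatorPosPart T := by
  have hcomm : ∀ x, T.1 (S.1 x) = S.1 (T.1 x) := fun x =>
    congrArg (fun R : orderBoundedOperators E => R.1 x) h
  set A := operatorPosPart T with hA
  have hA0 : 0 ≤ A := operatorPosPart_nonneg T
  have hAo : A ∈ (orthomorphisms E).toVectorSublattice := operatorPosPart_mem_orthomorphisms hT
  have hle : ∀ x, 0 ≤ x → A.1 (S.1 x) ≤ S.1 (A.1 x) := by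
    intro x hx
    have h1 : A.1 (S.1 x) - S.1 (A.1 x) ≤ A.1 (S.1 x) ⊓ (A - T).1 (S.1 x) := by
      refine le_inf (sub_le_self _ (hS _ (hA0 x hx))) ?_
      change _ ≤ A.1 (S.1 x) - T.1 (S.1 x)
      rw [hcomm]
      exact sub_le_sub_left (apply_le_apply_of_nonneg hS (le_operatorPosPart T x hx)) _
    rw [operatorPosPart_inf_negPart_apply hT (hS x hx)] at h1
    exact sub_nonpos.1 h1
  have hrange : ∀ x, 0 ≤ x → A.1 (S.1 (A.1 x)) = S.1 (A.1 (A.1 x)) := by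
    intro x hx
    have h1 : T.1 (A.1 x) = A.1 (A.1 x) := by
      have h2 : A.1 (A.1 x) - T.1 (A.1 x) = 0 := negPart_operatorPosPart_apply hT hx
      exact (sub_eq_zero.1 h2).symm
    rw [← h1, ← hcomm]
    refine operatorPosPart_apply_eq hT (hS _ (hA0 x hx)) ?_
    rw [hcomm, h1]
    exact hS _ (hA0 _ (hA0 x hx))
  refine le_antisymm hle fun x hx => ?_
  change S.1 (A.1 x) ≤ A.1 (S.1 x)
  rw [← sub_nonpos]
  refine nonpos_of_forall_nsmul_le (b := S.1 x) fun n => ?_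
  -- On `u = R⁺ x` the operator `A` is at most `1 / n`, while `x - u ≤ n A x`.
  set R : orderBoundedOperators E := 1 - n • A with hR
  have hRapp : ∀ z, R.1 z = z - n • A.1 z := fun z => by
    simp [hR]
  have hRo : R ∈ (orthomorphisms E).toVectorSublattice :=
    sub_mem one_mem_orthomorphisms (nsmul_mem hAo n)
  have hone : (0 : orderBoundedOperators E) ≤ 1 := fun z hz => hz
  set u := (operatorPosPart R).1 x with hu
  have hu0 : 0 ≤ u := operatorPosPart_nonneg R x hx
  have hux : u ≤ x := operatorPosPart_le (sub_le_self 1 (nsmul_nonneg hA0 n)) hone x hx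
  have hxu : x - u ≤ n • A.1 x := by
    have h1 : R.1 x ≤ u := le_operatorPosPart R x hx
    rw [hRapp] at h1
    exact sub_le_comm.1 h1
  have hAu : n • A.1 u ≤ u := by
    have h1 : (operatorPosPart R).1 u - R.1 u = 0 := negPart_operatorPosPart_apply hRo hx
    have h2 : 0 ≤ R.1 u := by
      rw [← sub_eq_zero.1 h1]
      exact operatorPosPart_nonneg R u hu0
    rwa [hRapp, sub_nonneg] at h2
  -- The operator `D = S A - A S` is positive and vanishes on the range of `A`.
  have hD : S.1 (A.1 x) - A.1 (S.1 x) ≤ S.1 (A.1 u) - A.1 (S.1 u) := by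
    have h1 := hle _ (sub_nonneg.2 hxu)
    have h2 := hrange x hx
    simp only [map_sub, map_nsmul, h2] at h1
    rw [← sub_nonneg] at h1 ⊢
    refine h1.trans (le_of_eq ?_)
    abel
  calc n • (S.1 (A.1 x) - A.1 (S.1 x)) ≤ n • (S.1 (A.1 u) - A.1 (S.1 u)) :=
        nsmul_le_nsmul_right hD n
    _ ≤ n • S.1 (A.1 u) := nsmul_le_nsmul_right (sub_le_self _ (hA0 _ (hS _ hu0))) n
    _ = S.1 (n • A.1 u) := (map_nsmul _ _ _).symm
    _ ≤ S.1 x := apply_le_apply_of_nonneg hS (hAu.trans hux)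

/-- A positive orthomorphism that is disjoint from the identity operator vanishes. -/
theorem eq_zero_of_inf_one_eq_zero {T : orderBoundedOperators E}
    (hT : T ∈ (orthomorphisms E).toVectorSublattice) (h0 : 0 ≤ T) (h : T ⊓ 1 = 0) : T = 0 := by
  have hpos : operatorPosPart (T - 1) = T := by
    rw [operator_inf_def, sub_eq_zero] at h
    exact h.symm
  refine le_antisymm (fun x hx => ?_) h0
  have h1 := operatorPosPart_inf_negPart_apply (sub_mem hT one_mem_orthomorphisms) hx
  rw [hpos, sub_sub_cancel] at h1
  refine (apply_eq_zero_of_disjoint hT ?_).le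
  rw [abs_of_nonneg (h0 x hx), abs_of_nonneg hx]
  exact h1

end Orthomorphisms

/-! ### Order limits of order bounded operators -/

section OrderLimits

theorem mem_orderBoundedOperators_of_nonneg {T : Module.End ℝ E} (hT : ∀ x, 0 ≤ x → 0 ≤ T x) :
    T ∈ orderBoundedOperators E := by
  have hmono : ∀ x y : E, x ≤ y → T x ≤ T y := fun x y h => by
    have := hT (y - x) (sub_nonneg.2 h)
    rwa [map_sub, sub_nonneg] at this
  rintro s ⟨a, ha⟩ ⟨b, hb⟩
  refine ⟨⟨T a, ?_⟩, ⟨T b, ?_⟩⟩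
  · rintro _ ⟨x, hx, rfl⟩
    exact hmono _ _ (ha hx)
  · rintro _ ⟨x, hx, rfl⟩
    exact hmono _ _ (hb hx)

/-- A decreasing net of positive operators has an infimum, which is the pointwise infimum on the
positive cone. -/
theorem exists_operator_isGLB {B : Type v} [Preorder B] [IsDirectedOrder B] [Nonempty B]
    {Y : B → orderBoundedOperators E} (hY : Antitone Y) (h0 : ∀ b, 0 ≤ Y b) :
    ∃ G : orderBoundedOperators E, 0 ≤ G ∧
      ∀ x, 0 ≤ x → IsGLB (Set.range fun b => (Y b).1 x) (G.1 x) := by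
  have hanti : ∀ x, 0 ≤ x → Antitone fun b => (Y b).1 x := fun x hx a b h => hY h x hx
  have hglb : ∀ x, 0 ≤ x → IsGLB (Set.range fun b => (Y b).1 x) (⨅ b, (Y b).1 x) := fun x hx =>
    isGLB_ciInf ⟨0, by rintro _ ⟨b, rfl⟩; exact h0 b x hx⟩
  obtain ⟨G, hG⟩ := exists_linear_extension (fun x => ⨅ b, (Y b).1 x) (by
      intro x y hx hy
      refine (hglb _ (add_nonneg hx hy)).unique ?_
      simp only [map_add]
      exact isGLB_range_add_of_antitone (hanti x hx) (hanti y hy) (hglb x hx) (hglb y hy)) (by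
      intro c x hc hx
      refine (hglb _ (smul_nonneg hc hx)).unique ?_
      simp only [map_smul]
      exact isGLB_range_smul hc (hglb x hx))
  have hpos : ∀ x, 0 ≤ x → 0 ≤ G x := fun x hx => by
    rw [hG x hx]
    exact le_ciInf fun b => h0 b x hx
  refine ⟨⟨G, mem_orderBoundedOperators_of_nonneg hpos⟩, hpos, fun x hx => ?_⟩
  change IsGLB _ (G x)
  rw [hG x hx]
  exact hglb x hx

theorem isGLB_apply_of_isGLB {B : Type v} [Preorder B] [IsDirectedOrder B] [Nonempty B]
    {Y : B → orderBoundedOperators E} (hY : Antitone Y) (h : IsGLB (Set.range Y) 0) {x : E}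
    (hx : 0 ≤ x) : IsGLB (Set.range fun b => (Y b).1 x) 0 := by
  obtain ⟨G, hG0, hG⟩ := exists_operator_isGLB hY fun b => h.1 ⟨b, rfl⟩
  have h1 : G ≤ 0 := h.2 (by
    rintro _ ⟨b, rfl⟩
    exact fun z hz => (hG z hz).1 ⟨b, rfl⟩)
  have h2 := hG x hx
  rwa [le_antisymm h1 hG0] at h2

theorem abs_apply_le_of_abs_le {T R : orderBoundedOperators E} (h : |T| ≤ R) {x : E}
    (hx : 0 ≤ x) : |T.1 x| ≤ R.1 x :=
  sup_le (((le_abs_self T).trans h) x hx) (((neg_le_abs T).trans h) x hx)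

theorem mem_orthomorphisms_of_orderConverges {A : Type u} [Preorder A] [IsDirectedOrder A]
    [Nonempty A] {T : A → orderBoundedOperators E} {l : orderBoundedOperators E}
    (hT : ∀ a, T a ∈ (orthomorphisms E).toVectorSublattice) (h : OrderConverges T l) :
    l ∈ (orthomorphisms E).toVectorSublattice := by
  obtain ⟨B, i1, i2, i3, Y, hY, hY0, hle⟩ := h
  intro K hK
  have hpos : ∀ x ∈ K, 0 ≤ x → l.1 x ∈ K := by
    intro x hx hx0
    have hmem : l.1 x ∈ orderAdherence (K : Set E) := by
      refine ⟨A, inferInstance, inferInstance, inferInstance, fun a => (T a).1 x,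
        fun a => hT a K hK x hx, B, i1, i2, i3, fun b => (Y b).1 x,
        fun b c hbc => hY hbc x hx0, isGLB_apply_of_isGLB hY hY0 hx0,
        fun b => (hle b).imp fun a₀ ha a haa => ?_⟩
      exact abs_apply_le_of_abs_le (ha a haa) hx0
    rwa [hK.orderClosed] at hmem
  intro x hx
  have hparts : x⁺ ∈ K ∧ x⁻ ∈ K := by
    refine ⟨hK.solid hx ?_, hK.solid hx ?_⟩
    · rw [abs_of_nonneg (posPart_nonneg _)]
      exact sup_le (le_abs_self _) (abs_nonneg _)
    · rw [abs_of_nonneg (negPart_nonneg _)]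
      exact sup_le (neg_le_abs _) (abs_nonneg _)
  rw [← posPart_sub_negPart x, map_sub]
  exact K.sub_mem (hpos _ hparts.1 (posPart_nonneg x)) (hpos _ hparts.2 (negPart_nonneg x))

theorem mul_comm_of_orderConverges {S : orderBoundedOperators E} (hS : 0 ≤ S)
    (hSc : IsOrderContinuous (S.1 : E →ₗ[ℝ] E)) {A : Type u} [Preorder A]
    {T : A → orderBoundedOperators E} {l : orderBoundedOperators E}
    (hT : ∀ a, T a * S = S * T a) (h : OrderConverges T l) : l * S = S * l := by
  obtain ⟨B, _, _, _, Y, hY, hY0, hle⟩ := h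
  have key : ∀ x, 0 ≤ x → |l.1 (S.1 x) - S.1 (l.1 x)| ≤ 0 := by
    intro x hx
    have h1 := isGLB_apply_of_isGLB hY hY0 (hS x hx)
    have h2 := hSc.isGLB_range hS (fun b c hbc => hY hbc x hx) (isGLB_apply_of_isGLB hY hY0 hx)
    have h3 := isGLB_range_add_of_antitone (fun b c hbc => hY hbc _ (hS x hx))
      (fun b c hbc => apply_le_apply_of_nonneg hS (hY hbc x hx)) h1 h2
    rw [add_zero] at h3
    refine h3.2 ?_
    rintro _ ⟨b, rfl⟩
    obtain ⟨a, ha⟩ := hle b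
    have hab := ha a le_rfl
    have hTa : (T a).1 (S.1 x) = S.1 ((T a).1 x) :=
      congrArg (fun R : orderBoundedOperators E => R.1 x) (hT a)
    have h4 : |(l - T a).1 (S.1 x)| ≤ (Y b).1 (S.1 x) := abs_apply_le_of_abs_le hab (hS x hx)
    have h5 : |(l - T a).1 x| ≤ (Y b).1 x := abs_apply_le_of_abs_le hab hx
    have h6 : |S.1 ((l - T a).1 x)| ≤ S.1 ((Y b).1 x) := by
      refine sup_le (apply_le_apply_of_nonneg hS ((le_abs_self _).trans h5)) ?_
      rw [← map_neg]
      exact apply_le_apply_of_nonneg hS ((neg_le_abs _).trans h5)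
    have h7 : l.1 (S.1 x) - S.1 (l.1 x)
        = (l - T a).1 (S.1 x) + -S.1 ((l - T a).1 x) := by
      have e : ∀ z, (l - T a).1 z = l.1 z - (T a).1 z := fun _ => rfl
      rw [e, e, map_sub, hTa]
      abel
    rw [h7]
    refine (abs_add_le _ _).trans (add_le_add h4 ?_)
    rwa [abs_neg]
  refine le_antisymm (fun x hx => ?_) (fun x hx => ?_)
  · exact sub_nonpos.1 ((le_abs_self _).trans (key x hx))
  · exact sub_nonneg.1 (neg_nonpos.1 ((neg_le_abs _).trans (key x hx)))

end OrderLimits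

/-! ### The commutant -/

section Commutant

variable {𝒮 : Set (orderBoundedOperators E)}

theorem mul_neg_comm_iff {T S : orderBoundedOperators E} : T * -S = -S * T ↔ T * S = S * T := by
  have h1 : T * -S = -(T * S) := Subtype.ext (LinearMap.ext fun x => map_neg T.1 (S.1 x))
  have h2 : -S * T = -(S * T) := rfl
  rw [h1, h2, neg_inj]

/-- The commutant in the orthomorphisms of a set of positive or negative operators, as a vector
lattice subalgebra. -/
def orthCommutantSubalgebra (𝒮 : Set (orderBoundedOperators E)) (h : ∀ S ∈ 𝒮, 0 ≤ S ∨ S ≤ 0) :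
    VectorLatticeSubalgebra (orderBoundedOperators E) :=
  have hadd : ∀ {T R : orderBoundedOperators E}, T ∈ orthCommutant 𝒮 → R ∈ orthCommutant 𝒮 →
      T + R ∈ orthCommutant 𝒮 := fun hT hR =>
    ⟨add_mem hT.1 hR.1, fun S hS => by rw [add_mul, mul_add, hT.2 S hS, hR.2 S hS]⟩
  have hsub : ∀ {T R : orderBoundedOperators E}, T ∈ orthCommutant 𝒮 → R ∈ orthCommutant 𝒮 →
      T - R ∈ orthCommutant 𝒮 := fun hT hR =>
    ⟨sub_mem hT.1 hR.1, fun S hS => by rw [sub_mul, mul_sub, hT.2 S hS, hR.2 S hS]⟩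
  have hpos : ∀ {T : orderBoundedOperators E}, T ∈ orthCommutant 𝒮 →
      operatorPosPart T ∈ orthCommutant 𝒮 := fun hT =>
    ⟨operatorPosPart_mem_orthomorphisms hT.1, fun S hS => by
      rcases h S hS with h0 | h0
      · exact operatorPosPart_mul_comm hT.1 h0 (hT.2 S hS)
      · have := operatorPosPart_mul_comm hT.1 (neg_nonneg.2 h0)
          (mul_neg_comm_iff.2 (hT.2 S hS))
        exact mul_neg_comm_iff.1 this⟩
  { carrier := orthCommutant 𝒮
    add_mem' := hadd
    zero_mem' := ⟨zero_mem _, fun S _ => by rw [zero_mul, mul_zero]⟩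
    smul_mem' := fun c _ hT => ⟨SMulMemClass.smul_mem c hT.1, fun S hS => by
      rw [smul_mul_assoc, mul_smul_comm, hT.2 S hS]⟩
    sup_mem' := fun hT hR => hadd (hpos (hsub hT hR)) hR
    inf_mem' := fun hT hR => hsub hT (hpos (hsub hT hR))
    mul_mem' := fun {T R} hT hR => ⟨(orthomorphisms E).mul_mem' hT.1 hR.1, fun S hS => by
      rw [mul_assoc, hR.2 S hS, ← mul_assoc, hT.2 S hS, mul_assoc]⟩ }

/-- The commutant is closed under order limits in the space of order bounded operators. -/
theorem mem_orthCommutant_of_orderConverges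
    (hoc : ∀ S ∈ 𝒮, IsOrderContinuous (S : E →ₗ[ℝ] E) ∧ (0 ≤ S ∨ S ≤ 0))
    {A : Type u} [Preorder A] [IsDirectedOrder A] [Nonempty A]
    {T : A → orderBoundedOperators E} {l : orderBoundedOperators E}
    (hT : ∀ a, T a ∈ orthCommutant 𝒮) (h : OrderConverges T l) : l ∈ orthCommutant 𝒮 := by
  refine ⟨mem_orthomorphisms_of_orderConverges (fun a => (hT a).1) h, fun S hS => ?_⟩
  obtain ⟨hSc, h0 | h0⟩ := hoc S hS
  · exact mul_comm_of_orderConverges h0 hSc (fun a => (hT a).2 S hS) h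
  · have := mul_comm_of_orderConverges (S := -S) (neg_nonneg.2 h0) hSc.neg
      (fun a => mul_neg_comm_iff.2 ((hT a).2 S hS)) h
    exact mul_neg_comm_iff.1 this

/-- If a vector sublattice `C` of operators is closed under order limits, then it is Dedekind
complete: the supremum of a set is the infimum of its upper bounds in `C`. -/
theorem isDedekindComplete_of_orderConverges_mem {C : VectorSublattice (orderBoundedOperators E)}
    (hC : ∀ (A : Type u) [Preorder A] [IsDirectedOrder A] [Nonempty A]
      (T : A → orderBoundedOperators E) (l : orderBoundedOperators E),
      (∀ a, T a ∈ C) → OrderConverges T l → l ∈ C) : IsDedekindComplete C := by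
  rintro s ⟨a, ha⟩ ⟨m, hm⟩
  -- The upper bounds form a decreasing net when indexed by themselves in the reversed order.
  let U := (↥(upperBounds s))ᵒᵈ
  have : IsDirectedOrder U := ⟨fun b c => ⟨OrderDual.toDual
    ⟨(OrderDual.ofDual b).1 ⊓ (OrderDual.ofDual c).1, fun x hx =>
      le_inf ((OrderDual.ofDual b).2 hx) ((OrderDual.ofDual c).2 hx)⟩,
    inf_le_left (a := (OrderDual.ofDual b).1), inf_le_right (a := (OrderDual.ofDual b).1)⟩⟩
  have : Nonempty U := ⟨OrderDual.toDual ⟨m, hm⟩⟩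
  let X : U → orderBoundedOperators E := fun b => ((OrderDual.ofDual b).1 : C)
  have hX : Antitone X := fun b c h => h
  obtain ⟨G, -, hG⟩ := exists_operator_isGLB
    (Y := fun b => X b - (a : orderBoundedOperators E))
    (fun b c h => sub_le_sub_right (hX h) _)
    (fun b => sub_nonneg.2 ((OrderDual.ofDual b).2 ha : (a : orderBoundedOperators E) ≤ X b))
  have hglb : IsGLB (Set.range X) (G + a) := by
    constructor
    · rintro _ ⟨b, rfl⟩
      rw [← le_sub_iff_add_le]
      exact fun x hx => (hG x hx).1 ⟨b, rfl⟩
    · intro R hR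
      rw [← sub_le_iff_le_add]
      refine fun x hx => (hG x hx).2 ?_
      rintro _ ⟨b, rfl⟩
      exact sub_le_sub_right (hR ⟨b, rfl⟩) (a : orderBoundedOperators E) x hx
  have hmem : G + a ∈ C := hC U X _ (fun b => (OrderDual.ofDual b).1.2)
    (orderConverges_of_antitone hX hglb)
  refine ⟨⟨G + a, hmem⟩, fun x hx => ?_, fun b hb => ?_⟩
  · refine hglb.2 ?_
    rintro _ ⟨b, rfl⟩
    exact (OrderDual.ofDual b).2 hx
  · exact hglb.1 ⟨OrderDual.toDual ⟨b, hb⟩, rfl⟩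

end Commutant

theorem mainTheorem10 {E : Type u} [AddCommGroup E] [ConditionallyCompleteLattice E]
    [IsOrderedAddMonoid E] [Module ℝ E] [IsOrderedModule ℝ E]
    (𝒮 : Set (orderBoundedOperators E)) (h𝒮 : 𝒮.Nonempty)
    (hoc : ∀ S ∈ 𝒮, IsOrderContinuous (S : E →ₗ[ℝ] E) ∧ (0 ≤ S ∨ S ≤ 0)) :
    ∃ C : VectorLatticeSubalgebra (orderBoundedOperators E),
      (C.toVectorSublattice : Set (orderBoundedOperators E)) = orthCommutant 𝒮 ∧
      (∃ h1 : (1 : orderBoundedOperators E) ∈ C.toVectorSublattice,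
        IsWeakOrderUnit (⟨1, h1⟩ : C.toVectorSublattice)) ∧
      (∀ F : VectorSublattice (orderBoundedOperators E), F.IsRegular →
        (C.toVectorSublattice : Set (orderBoundedOperators E)) ⊆ F →
          IsOrderClosed (C.toVectorSublattice.within F : Set F)) ∧
      (∀ F : VectorSublattice (orderBoundedOperators E), F.IsRegular → IsDedekindComplete F →
        (C.toVectorSublattice : Set (orderBoundedOperators E)) ⊆ F →
          (C.toVectorSublattice.within F).IsRegular) ∧
      IsDedekindComplete C.toVectorSublattice := by
  have hclosed : ∀ F : VectorSublattice (orderBoundedOperators E), F.IsRegular →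
      IsOrderClosed ((orthCommutantSubalgebra 𝒮 fun S hS => (hoc S hS).2).toVectorSublattice.within
        F : Set F) := by
    intro F hF
    refine Set.Subset.antisymm ?_ (subset_orderAdherence _)
    rintro l ⟨A, _, _, _, x, hx, hconv⟩
    exact mem_orthCommutant_of_orderConverges hoc hx (hF.orderConverges_coe hconv)
  have h1 : (1 : orderBoundedOperators E) ∈ orthCommutant 𝒮 :=
    ⟨one_mem_orthomorphisms, fun S _ => by rw [one_mul, mul_one]⟩
  refine ⟨orthCommutantSubalgebra 𝒮 fun S hS => (hoc S hS).2, rfl,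
    ⟨h1, fun x hx => hx, fun X hX => ?_⟩, fun F hF _ => hclosed F hF,
    fun F hF hFc _ => VectorSublattice.isRegular_of_isOrderClosed hFc (hclosed F hF),
    isDedekindComplete_of_orderConverges_mem fun A _ _ _ T l hT h =>
      mem_orthCommutant_of_orderConverges hoc hT h⟩
  have h2 : |(X : orderBoundedOperators E)| ⊓ 1 = 0 := congrArg Subtype.val hX
  have habs : |(X : orderBoundedOperators E)| ∈ (orthomorphisms E).toVectorSublattice :=
    (orthomorphisms E).toVectorSublattice.sup_mem' X.2.1 (neg_mem X.2.1)
  have h3 := eq_zero_of_inf_one_eq_zero habs (abs_nonneg _) h2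
  refine Subtype.ext (le_antisymm ?_ ?_)
  · exact (le_abs_self _).trans h3.le
  · exact neg_nonpos.1 ((neg_le_abs _).trans h3.le)

end
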